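/- Let $m,n\ge 1$, let $A$ be a fixed real $m\times n$ matrix, and let $X$ be a random real $m\times n$ matrix whose entries $X_{jk}$ are independent random variables with $\mathbb{E}X_{jk}=a_{jk}$ for all $j,k$, i.e. $\mathbb{E}X=A$. Let $D>0$ and assume that $|X_{jk}|\le D/2$ almost surely for all $j,k$. Write $\|\cdot\|$ for the spectral norm (the largest singular value). Then $\mathbb{E}\|A-X\|$ is finite and, for every $\delta>0$, $$\mathbb{P}\bigl(\|A-X\|>(1+\delta)\,\mathbb{E}\|A-X\|\bigr)\le \exp\left(-\frac{\delta^{2}\,(\mathbb{E}\|A-X\|)^{2}}{4D^{2}}\right).$$ -/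

import Mathlib

open MeasureTheory ProbabilityTheory

-- `‖M‖` for a matrix `M` is its spectral norm: the operator norm of `M` between the
-- Euclidean spaces, that is, the largest singular value of `M`.
open scoped Matrix.Norms.L2Operator

/-! As a function of the entries, `‖A - X‖` is convex and 1-Lipschitz for the Euclidean norm, so
this is Talagrand's concentration inequality for convex functions of independent bounded variables,
proved by Maurey's method. Property (τ) with cost `x ^ 2 / (4 * D ^ 2)` holds for each law on an
interval of length `D` (`convexTau_Icc`) and tensorizes (`ConvexTau.prod`, `convexTau_pi`). Applied
to `t * f`, it bounds the exponential moments of `f`, since infimal convolution lowers a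
`t`-Lipschitz function by at most `t ^ 2 * D ^ 2`; Chernoff's bound with deviation `δ * 𝔼 f`
concludes. -/

/-- The infimal convolution of `φ`, restricted to `K`, with the cost function `c`. -/
noncomputable def infConv {E : Type*} [AddGroup E] (K : Set E) (c φ : E → ℝ) (x : E) : ℝ :=
  sInf ((fun y => φ y + c (x - y)) '' K)

/-- Maurey's convex property (τ) of the measure `μ` on the set `K` for the cost function `c`. -/
def ConvexTau {E : Type*} [NormedAddCommGroup E] [NormedSpace ℝ E] [MeasurableSpace E]
    (μ : Measure E) (K : Set E) (c : E → ℝ) : Prop :=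
  ∀ φ : E → ℝ, Continuous φ → ConvexOn ℝ Set.univ φ →
    (∫ x, Real.exp (infConv K c φ x) ∂μ) * ∫ x, Real.exp (-φ x) ∂μ ≤ 1

/-! ### Infimal convolution over a compact set -/

section InfConv

variable {E : Type*} [NormedAddCommGroup E]

theorem bddBelow_image_add_cost {K : Set E} (hK : IsCompact K) {c φ : E → ℝ}
    (hc : Continuous c) (hφ : Continuous φ) (x : E) :
    BddBelow ((fun y => φ y + c (x - y)) '' K) :=
  hK.bddBelow_image (by fun_prop)

theorem infConv_le {K : Set E} (hK : IsCompact K) {c φ : E → ℝ}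
    (hc : Continuous c) (hφ : Continuous φ) (x : E) {y : E} (hy : y ∈ K) :
    infConv K c φ x ≤ φ y + c (x - y) :=
  csInf_le (bddBelow_image_add_cost hK hc hφ x) ⟨y, hy, rfl⟩

theorem le_infConv {K : Set E} (hne : K.Nonempty) {c φ : E → ℝ} {x : E} {b : ℝ}
    (h : ∀ y ∈ K, b ≤ φ y + c (x - y)) : b ≤ infConv K c φ x := by
  refine le_csInf (hne.image _) ?_
  rintro _ ⟨y, hy, rfl⟩
  exact h y hy

theorem exists_infConv_eq {K : Set E} (hK : IsCompact K) (hne : K.Nonempty) {c φ : E → ℝ}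
    (hc : Continuous c) (hφ : Continuous φ) (x : E) :
    ∃ y ∈ K, infConv K c φ x = φ y + c (x - y) := by
  obtain ⟨y, hy, hmin⟩ := hK.exists_sInf_image_eq hne
    (f := fun y => φ y + c (x - y)) (by fun_prop)
  exact ⟨y, hy, hmin⟩

theorem continuous_infConv_section {F : Type*} [TopologicalSpace F] {K : Set E}
    (hK : IsCompact K) {c : E → ℝ} {φ : E × F → ℝ} (hc : Continuous c) (hφ : Continuous φ) :
    Continuous fun p : E × F => infConv K c (fun x => φ (x, p.2)) p.1 := by
  refine hK.continuous_sInf (f := fun (p : E × F) y => φ (y, p.2) + c (p.1 - y)) ?_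
  change Continuous fun q : (E × F) × E => φ (q.2, q.1.2) + c (q.1.1 - q.2)
  fun_prop

theorem continuous_infConv {K : Set E} (hK : IsCompact K) {c φ : E → ℝ}
    (hc : Continuous c) (hφ : Continuous φ) : Continuous (infConv K c φ) := by
  refine hK.continuous_sInf (f := fun x y => φ y + c (x - y)) ?_
  change Continuous fun q : E × E => φ q.2 + c (q.1 - q.2)
  fun_prop

/-- The convex combination of minimizers for `z` and `w` is a competitor at the intermediate point;
it stays in `K` because `K` is convex. -/
theorem convexOn_infConv_section [NormedSpace ℝ E] {F : Type*} [NormedAddCommGroup F]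
    [NormedSpace ℝ F] {K : Set E} (hK : IsCompact K) (hne : K.Nonempty) (hKc : Convex ℝ K)
    {c : E → ℝ} {φ : E × F → ℝ} (hc : Continuous c) (hcc : ConvexOn ℝ Set.univ c)
    (hφ : Continuous φ) (hφc : ConvexOn ℝ Set.univ φ) (x : E) :
    ConvexOn ℝ Set.univ fun z : F => infConv K c (fun x => φ (x, z)) x := by
  refine ⟨convex_univ, fun z _ w _ a b ha hb hab => ?_⟩
  obtain ⟨y, hy, hyz⟩ := exists_infConv_eq hK hne hc (φ := fun x => φ (x, z)) (by fun_prop) x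
  obtain ⟨v, hv, hvw⟩ := exists_infConv_eq hK hne hc (φ := fun x => φ (x, w)) (by fun_prop) x
  simp only [hyz, hvw]
  refine (infConv_le hK hc (φ := fun x => φ (x, a • z + b • w)) (by fun_prop) x
    (hKc hy hv ha hb hab)).trans ?_
  have h₁ := hφc.2 (Set.mem_univ (y, z)) (Set.mem_univ (v, w)) ha hb hab
  have h₂ := hcc.2 (Set.mem_univ (x - y)) (Set.mem_univ (x - v)) ha hb hab
  have h₃ : x - (a • y + b • v) = a • (x - y) + b • (x - v) := by
    have : x = a • x + b • x := by rw [← add_smul, hab, one_smul]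
    nth_rw 1 [this]
    simp only [smul_sub]
    abel
  simp only [Prod.smul_mk, Prod.mk_add_mk, smul_eq_mul] at h₁ h₂ ⊢
  rw [h₃]
  linarith

end InfConv

/-! ### Log-exponential integrals -/

section Integration

theorem restrict_eq_self_of_compl_null {E : Type*} [MeasurableSpace E] {μ : Measure E}
    {K : Set E} (h : μ Kᶜ = 0) : μ.restrict K = μ :=
  Measure.restrict_eq_self_of_ae_mem (mem_ae_iff.2 h)

variable {E : Type*} [NormedAddCommGroup E] [MeasurableSpace E] [BorelSpace E]

theorem integrable_of_continuous_of_compl_null {μ : Measure E}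
    [IsFiniteMeasure μ] {K : Set E} (hK : IsCompact K) (h : μ Kᶜ = 0) {f : E → ℝ}
    (hf : Continuous f) : Integrable f μ := by
  have := hf.continuousOn.integrableOn_compact (μ := μ) hK
  rwa [IntegrableOn, restrict_eq_self_of_compl_null h] at this

/-- This is Hölder's inequality, obtained by normalizing both exponentials to integral 1 and using
convexity of `exp` pointwise. -/
theorem convexOn_log_integral_exp {μ : Measure E} [IsProbabilityMeasure μ] {K : Set E}
    (hK : IsCompact K) (hμ : μ Kᶜ = 0) {F : Type*} [NormedAddCommGroup F] [NormedSpace ℝ F]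
    {h : E × F → ℝ} (hh : Continuous h)
    (hconv : ∀ x, ConvexOn ℝ Set.univ fun z => h (x, z)) :
    ConvexOn ℝ Set.univ fun z => Real.log (∫ x, Real.exp (h (x, z)) ∂μ) := by
  have hint : ∀ z, Integrable (fun x => Real.exp (h (x, z))) μ := fun z =>
    integrable_of_continuous_of_compl_null hK hμ (by fun_prop)
  refine ⟨convex_univ, fun z _ w _ a b ha hb hab => ?_⟩
  have hexp : ∀ z, Real.exp (Real.log (∫ x, Real.exp (h (x, z)) ∂μ))
      = ∫ x, Real.exp (h (x, z)) ∂μ := fun z => Real.exp_log (integral_exp_pos (hint z))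
  set α := Real.log (∫ x, Real.exp (h (x, z)) ∂μ)
  set β := Real.log (∫ x, Real.exp (h (x, w)) ∂μ)
  have hnorm : ∀ z, ∫ x, Real.exp (h (x, z) - Real.log (∫ x, Real.exp (h (x, z)) ∂μ)) ∂μ = 1 := by
    intro z
    simp only [Real.exp_sub, hexp]
    rw [integral_div, div_self (integral_exp_pos (hint z)).ne']
  have hint' : ∀ z r, Integrable (fun x => Real.exp (h (x, z) - r)) μ := fun z r =>
    integrable_of_continuous_of_compl_null hK hμ (by fun_prop)
  rw [Real.log_le_iff_le_exp (integral_exp_pos (hint _))]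
  have hpt : ∀ x, Real.exp (h (x, a • z + b • w)) ≤ Real.exp (a • α + b • β) *
      (a * Real.exp (h (x, z) - α) + b * Real.exp (h (x, w) - β)) := by
    intro x
    have h₁ := (hconv x).2 (Set.mem_univ z) (Set.mem_univ w) ha hb hab
    have h₂ := convexOn_exp.2 (Set.mem_univ (h (x, z) - α)) (Set.mem_univ (h (x, w) - β))
      ha hb hab
    simp only [smul_eq_mul] at h₁ h₂ ⊢
    calc Real.exp (h (x, a • z + b • w))
        ≤ Real.exp ((a * α + b * β) + (a * (h (x, z) - α) + b * (h (x, w) - β))) :=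
          Real.exp_le_exp.2 (by linarith)
      _ ≤ _ := by rw [Real.exp_add]; gcongr
  calc ∫ x, Real.exp (h (x, a • z + b • w)) ∂μ
      ≤ ∫ x, Real.exp (a • α + b • β) *
        (a * Real.exp (h (x, z) - α) + b * Real.exp (h (x, w) - β)) ∂μ :=
        integral_mono (hint _) ((((hint' z α).const_mul a).add
          ((hint' w β).const_mul b)).const_mul _) hpt
    _ = Real.exp (a • α + b • β) := by
        rw [integral_const_mul, integral_add ((hint' z α).const_mul a) ((hint' w β).const_mul b),
          integral_const_mul, integral_const_mul, hnorm z, hnorm w]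
        simp [hab]

theorem continuous_log_integral_exp {μ : Measure E} [IsProbabilityMeasure μ]
    [SecondCountableTopology E] {K : Set E}
    (hK : IsCompact K) (hμ : μ Kᶜ = 0) {F : Type*} [NormedAddCommGroup F] [ProperSpace F]
    {h : E × F → ℝ} (hh : Continuous h) :
    Continuous fun z => Real.log (∫ x, Real.exp (h (x, z)) ∂μ) := by
  have hcont : Continuous fun z => ∫ x, Real.exp (h (x, z)) ∂μ := by
    have := continuous_parametric_integral_of_continuous (μ := μ) (s := K)
      (f := fun (z : F) (x : E) => Real.exp (h (x, z)))
      (by change Continuous fun p : F × E => Real.exp (h (p.2, p.1)); fun_prop) hK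
    rwa [restrict_eq_self_of_compl_null hμ] at this
  exact hcont.log fun z => (integral_exp_pos
    (integrable_of_continuous_of_compl_null hK hμ (by fun_prop))).ne'

end Integration

/-! ### Tensorization and transport of property (τ) -/

theorem ConvexTau.prod {E F : Type*}
    [NormedAddCommGroup E] [NormedSpace ℝ E] [MeasurableSpace E] [BorelSpace E]
    [SecondCountableTopology E]
    [NormedAddCommGroup F] [NormedSpace ℝ F] [MeasurableSpace F] [BorelSpace F]
    [SecondCountableTopology F] [ProperSpace F]
    {μ : Measure E} [IsProbabilityMeasure μ] {ν : Measure F} [IsProbabilityMeasure ν]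
    {K : Set E} {L : Set F} {c : E → ℝ} {d : F → ℝ}
    (hK : IsCompact K) (hKne : K.Nonempty) (hKc : Convex ℝ K) (hμ : μ Kᶜ = 0)
    (hL : IsCompact L) (hLne : L.Nonempty) (hν : ν Lᶜ = 0)
    (hc : Continuous c) (hcc : ConvexOn ℝ Set.univ c) (hd : Continuous d)
    (h₁ : ConvexTau μ K c) (h₂ : ConvexTau ν L d) :
    ConvexTau (μ.prod ν) (K ×ˢ L) (fun p => c p.1 + d p.2) := by
  intro φ hφ hφc
  have hKL : IsCompact (K ×ˢ L) := hK.prod hL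
  have hμν : (μ.prod ν) (K ×ˢ L)ᶜ = 0 := by
    have h1 : ∀ᵐ p ∂(μ.prod ν), p.1 ∈ K := Measure.quasiMeasurePreserving_fst.ae hμ
    have h2 : ∀ᵐ p ∂(μ.prod ν), p.2 ∈ L := Measure.quasiMeasurePreserving_snd.ae hν
    exact (h1.and h2)
  set h : E × F → ℝ := fun p => infConv K c (fun x => φ (x, p.2)) p.1 with h_def
  have hh : Continuous h := continuous_infConv_section hK hc hφ
  -- Property (τ) of `μ` on sections and of `ν` on `ψ` combine; the latter needs `ψ` convex, hence
  -- the convexity lemmas above.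
  set ψ : F → ℝ := fun z => Real.log (∫ x, Real.exp (h (x, z)) ∂μ) with ψ_def
  have hψ : Continuous ψ := continuous_log_integral_exp hK hμ hh
  have hψc : ConvexOn ℝ Set.univ ψ := convexOn_log_integral_exp hK hμ hh
    fun x => convexOn_infConv_section hK hKne hKc hc hcc hφ hφc x
  have hpos : ∀ z, 0 < ∫ x, Real.exp (h (x, z)) ∂μ := fun z => integral_exp_pos
    (integrable_of_continuous_of_compl_null hK hμ (by fun_prop))
  have hcont : Continuous (infConv (K ×ˢ L) (fun p : E × F => c p.1 + d p.2) φ) :=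
    continuous_infConv hKL (by fun_prop) hφ
  have hsecφ : ∀ z, ConvexOn ℝ Set.univ fun x => φ (x, z) := by
    intro z
    refine ⟨convex_univ, fun x _ y _ a b ha hb hab => ?_⟩
    have := hφc.2 (Set.mem_univ (x, z)) (Set.mem_univ (y, z)) ha hb hab
    simpa [← add_smul, hab] using this
  have hA : ∫ p, Real.exp (-φ p) ∂(μ.prod ν) ≤ ∫ z, Real.exp (-ψ z) ∂ν := by
    have hi := integrable_of_continuous_of_compl_null hKL hμν
      (f := fun p => Real.exp (-φ p)) (by fun_prop)
    rw [integral_prod_symm _ hi]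
    refine integral_mono hi.integral_prod_right
      (integrable_of_continuous_of_compl_null hL hν (by fun_prop)) fun z => ?_
    have := h₁ (fun x => φ (x, z)) (by fun_prop) (hsecφ z)
    simp only [ψ_def, Real.exp_neg, Real.exp_log (hpos z)]
    simp only [Real.exp_neg] at this
    rwa [← one_div, le_div_iff₀' (hpos z)]
  have hB : ∫ p, Real.exp (infConv (K ×ˢ L) (fun p : E × F => c p.1 + d p.2) φ p) ∂(μ.prod ν)
      ≤ ∫ w, Real.exp (infConv L d ψ w) ∂ν := by
    have hi := integrable_of_continuous_of_compl_null hKL hμν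
      (f := fun p => Real.exp (infConv (K ×ˢ L) (fun p : E × F => c p.1 + d p.2) φ p))
      (by fun_prop)
    have hψi := continuous_infConv hL hd hψ
    rw [integral_prod_symm _ hi]
    refine integral_mono hi.integral_prod_right
      (integrable_of_continuous_of_compl_null hL hν (by fun_prop)) fun w => ?_
    -- The outer minimizer `z` does not depend on `x`; paired with an inner minimizer `y` it is a
    -- competitor on `K ×ˢ L`.
    obtain ⟨z, hz, hzw⟩ := exists_infConv_eq hL hLne hd hψ w
    have hexp : Real.exp (ψ z) = ∫ x, Real.exp (h (x, z)) ∂μ := Real.exp_log (hpos z)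
    change _ ≤ Real.exp (infConv L d ψ w)
    rw [hzw, Real.exp_add, hexp, ← integral_mul_const]
    refine integral_mono (integrable_of_continuous_of_compl_null hK hμ (by fun_prop))
      (integrable_of_continuous_of_compl_null hK hμ (by fun_prop)) fun x => ?_
    simp only [← Real.exp_add]
    refine Real.exp_le_exp.2 ?_
    obtain ⟨y, hy, hyx⟩ := exists_infConv_eq hK hKne hc (φ := fun x => φ (x, z))
      (by fun_prop) x
    have := infConv_le hKL (c := fun p : E × F => c p.1 + d p.2) (by fun_prop) hφ (x, w)
      (y := (y, z)) ⟨hy, hz⟩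
    simp only [h_def, hyx]
    simp only [Prod.mk_sub_mk] at this
    linarith
  calc _ ≤ (∫ w, Real.exp (infConv L d ψ w) ∂ν) * ∫ z, Real.exp (-ψ z) ∂ν := by
        gcongr
    _ ≤ 1 := h₂ ψ hψ hψc

theorem ConvexTau.of_measurePreserving {E F : Type*}
    [NormedAddCommGroup E] [NormedSpace ℝ E] [MeasurableSpace E] [BorelSpace E]
    [NormedAddCommGroup F] [NormedSpace ℝ F] [MeasurableSpace F] [BorelSpace F]
    {μ : Measure E} {ν : Measure F} {L : Set F} {d : F → ℝ} (e : E ≃L[ℝ] F)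
    (he : MeasurePreserving e μ ν) (h : ConvexTau ν L d) :
    ConvexTau μ (e ⁻¹' L) (fun x => d (e x)) := by
  intro φ hφ hφc
  have hemb : MeasurableEmbedding e := e.toHomeomorph.measurableEmbedding
  have key := h (fun y => φ (e.symm y)) (by fun_prop)
    (hφc.comp_linearMap (e.symm : F →ₗ[ℝ] E))
  rw [← he.integral_comp hemb, ← he.integral_comp hemb] at key
  have hinf : ∀ x, infConv L d (fun y => φ (e.symm y)) (e x)
      = infConv (e ⁻¹' L) (fun x => d (e x)) φ x := by
    intro x
    unfold infConv
    congr 1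
    rw [← e.image_symm_eq_preimage, Set.image_image]
    simp
  simpa only [hinf, ContinuousLinearEquiv.symm_apply_apply] using key

/-! ### Property (τ) on an interval and on the cube -/

theorem exp_sub_sq_add_exp_neg_le {u : ℝ} (h₀ : 0 ≤ u) (h₁ : u ≤ 1) :
    Real.exp (u - u ^ 2) + Real.exp (-u) ≤ 2 := by
  have h := Real.cosh_le_exp_half_sq (u - u ^ 2 / 2)
  rw [Real.cosh_eq] at h
  have hsq : (u - u ^ 2 / 2) ^ 2 ≤ u ^ 2 := by
    apply pow_le_pow_left₀ <;> nlinarith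
  have e₁ : Real.exp (u - u ^ 2) = Real.exp (-(u ^ 2 / 2)) * Real.exp (u - u ^ 2 / 2) := by
    rw [← Real.exp_add]; ring_nf
  have e₂ : Real.exp (-u) = Real.exp (-(u ^ 2 / 2)) * Real.exp (-(u - u ^ 2 / 2)) := by
    rw [← Real.exp_add]; ring_nf
  calc Real.exp (u - u ^ 2) + Real.exp (-u)
      = Real.exp (-(u ^ 2 / 2)) *
        (Real.exp (u - u ^ 2 / 2) + Real.exp (-(u - u ^ 2 / 2))) := by rw [e₁, e₂]; ring
    _ ≤ Real.exp (-(u ^ 2 / 2)) * (2 * Real.exp ((u - u ^ 2 / 2) ^ 2 / 2)) := by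
        gcongr; linarith
    _ = 2 * Real.exp (((u - u ^ 2 / 2) ^ 2 - u ^ 2) / 2) := by
        rw [mul_left_comm, ← Real.exp_add]; ring_nf
    _ ≤ 2 * 1 := by
        gcongr; rw [Real.exp_le_one_iff]; linarith
    _ = 2 := mul_one 2

theorem exists_exp_interpolation_le {u : ℝ} (h₀ : 0 ≤ u) :
    ∃ θ ∈ Set.Icc (0 : ℝ) 1, Real.exp ((1 - θ) * u + θ ^ 2 / 4) ≤ 2 - Real.exp (-u) := by
  rcases le_total u (1 / 2) with h | h
  -- `θ = 2 * u` minimizes the exponent; it is capped at 1 in the other case.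
  · refine ⟨2 * u, ⟨by linarith, by linarith⟩, ?_⟩
    have := exp_sub_sq_add_exp_neg_le h₀ (by linarith)
    rw [show (1 - 2 * u) * u + (2 * u) ^ 2 / 4 = u - u ^ 2 by ring]
    linarith
  · refine ⟨1, ⟨zero_le_one, le_rfl⟩, ?_⟩
    have h₁ := exp_sub_sq_add_exp_neg_le (u := 1 / 2) (by norm_num) (by norm_num)
    have h₂ : Real.exp (-u) ≤ Real.exp (-(1 / 2)) := Real.exp_le_exp.2 (by linarith)
    rw [show (1 - 1) * u + (1 : ℝ) ^ 2 / 4 = 1 / 2 - (1 / 2) ^ 2 by ring]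
    linarith

theorem convexTau_Icc {D : ℝ} (hD : 0 < D) (μ : Measure ℝ) [IsProbabilityMeasure μ]
    (hμ : μ (Set.Icc (-(D / 2)) (D / 2))ᶜ = 0) :
    ConvexTau μ (Set.Icc (-(D / 2)) (D / 2)) (fun x => x ^ 2 / (4 * D ^ 2)) := by
  intro φ hφ hφc
  set K := Set.Icc (-(D / 2)) (D / 2)
  have hK : IsCompact K := isCompact_Icc
  have hne : K.Nonempty := Set.nonempty_Icc.2 (by linarith)
  obtain ⟨y, hy, hmin⟩ := hK.exists_isMinOn hne hφ.continuousOn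
  have hcost : Continuous fun x : ℝ => x ^ 2 / (4 * D ^ 2) := by fun_prop
  have hcont := continuous_infConv hK hcost hφ
  have hi : ∀ f : ℝ → ℝ, Continuous f → Integrable f μ := fun f hf =>
    integrable_of_continuous_of_compl_null hK hμ hf
  have hpt : ∀ x ∈ K, Real.exp (-φ y) * Real.exp (infConv K (fun x => x ^ 2 / (4 * D ^ 2)) φ x)
      ≤ 2 - Real.exp (φ y) * Real.exp (-φ x) := by
    intro x hx
    obtain ⟨θ, ⟨hθ₀, hθ₁⟩, hθ⟩ := exists_exp_interpolation_le (sub_nonneg.2 (hmin hx))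
    rw [← Real.exp_add, ← Real.exp_add]
    refine le_trans (Real.exp_le_exp.2 ?_) (hθ.trans_eq (by ring_nf))
    -- Moving from `x` towards the minimizer `y` of `φ` trades a decrease of `φ` against the cost.
    have hmem : (1 - θ) • x + θ • y ∈ K :=
      convex_Icc _ _ hx hy (by linarith) hθ₀ (by ring)
    have h₁ := infConv_le hK hcost hφ x hmem
    have h₂ := hφc.2 (Set.mem_univ x) (Set.mem_univ y) (sub_nonneg.2 hθ₁) hθ₀ (by ring)
    have h₃ : (x - ((1 - θ) • x + θ • y)) ^ 2 / (4 * D ^ 2) ≤ θ ^ 2 / 4 := by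
      simp only [smul_eq_mul]
      rw [show x - ((1 - θ) * x + θ * y) = θ * (x - y) by ring, mul_pow,
        div_le_div_iff₀ (by positivity) (by norm_num)]
      have : (x - y) ^ 2 ≤ D ^ 2 :=
        sq_le_sq' (by linarith [hx.1, hy.2]) (by linarith [hx.2, hy.1])
      nlinarith [mul_le_mul_of_nonneg_left this (sq_nonneg θ)]
    simp only [smul_eq_mul] at h₁ h₂ h₃
    linarith
  have hint : Real.exp (-φ y) * ∫ x, Real.exp (infConv K (fun x => x ^ 2 / (4 * D ^ 2)) φ x) ∂μ
      ≤ 2 - Real.exp (φ y) * ∫ x, Real.exp (-φ x) ∂μ := by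
    rw [← integral_const_mul, ← integral_const_mul]
    calc _ ≤ ∫ x, (2 - Real.exp (φ y) * Real.exp (-φ x)) ∂μ := by
          refine integral_mono_ae (hi _ (by fun_prop)) (hi _ (by fun_prop)) ?_
          filter_upwards [show ∀ᵐ x ∂μ, x ∈ K from mem_ae_iff.2 hμ] with x hx using hpt x hx
      _ = _ := by
          rw [integral_sub (integrable_const _) (hi _ (by fun_prop))]
          simp
  set I := ∫ x, Real.exp (infConv K (fun x => x ^ 2 / (4 * D ^ 2)) φ x) ∂μ
  have hJ : 0 ≤ ∫ x, Real.exp (-φ x) ∂μ := integral_nonneg fun _ => (Real.exp_pos _).le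
  set J := ∫ x, Real.exp (-φ x) ∂μ
  have hprod : Real.exp (-φ y) * Real.exp (φ y) = 1 := by rw [← Real.exp_add]; simp
  calc I * J = (Real.exp (-φ y) * I) * (Real.exp (φ y) * J) := by
        linear_combination (-(I * J)) * hprod
    _ ≤ (2 - Real.exp (φ y) * J) * (Real.exp (φ y) * J) := by gcongr
    -- `(2 - b) * b ≤ 1` for every real `b`.
    _ ≤ 1 := by nlinarith [sq_nonneg (Real.exp (φ y) * J - 1)]

theorem pi_compl_cube_eq_zero {N : ℕ} {D : ℝ} {μ : Fin N → Measure ℝ}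
    [∀ i, IsProbabilityMeasure (μ i)] (hμ : ∀ i, μ i (Set.Icc (-(D / 2)) (D / 2))ᶜ = 0) :
    Measure.pi μ (Set.univ.pi fun _ => Set.Icc (-(D / 2)) (D / 2))ᶜ = 0 := by
  have : ∀ᵐ x ∂(Measure.pi μ), ∀ i, x i ∈ Set.Icc (-(D / 2)) (D / 2) := ae_all_iff.2 fun i =>
    (Measure.quasiMeasurePreserving_eval μ i).ae (hμ i)
  exact mem_ae_iff.1 (this.mono fun x hx i _ => hx i)

theorem convexTau_pi {D : ℝ} (hD : 0 < D) : ∀ (N : ℕ) (μ : Fin N → Measure ℝ)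
    [∀ i, IsProbabilityMeasure (μ i)], (∀ i, μ i (Set.Icc (-(D / 2)) (D / 2))ᶜ = 0) →
    ConvexTau (Measure.pi μ) (Set.univ.pi fun _ => Set.Icc (-(D / 2)) (D / 2))
      (fun x => (∑ i, x i ^ 2) / (4 * D ^ 2)) := by
  intro N
  induction N with
  | zero =>
    intro μ _ _ φ hφ _
    have hmass : ∀ f : (Fin 0 → ℝ) → ℝ, ∫ x, f x ∂(Measure.pi μ) = f 0 := by
      intro f
      rw [Measure.pi_of_empty μ 0, integral_dirac]
    rw [hmass, hmass]
    have : infConv (Set.univ.pi fun _ => Set.Icc (-(D / 2)) (D / 2))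
        (fun x : Fin 0 → ℝ => (∑ i, x i ^ 2) / (4 * D ^ 2)) φ 0 ≤ φ 0 := by
      refine (infConv_le (isCompact_univ_pi fun _ => isCompact_Icc) (by fun_prop) hφ 0
        (y := 0) (by simp)).trans (by simp)
    rw [← Real.exp_add, Real.exp_le_one_iff]
    linarith
  | succ N ih =>
    intro μ _ hμ
    have hne : (Set.Icc (-(D / 2)) (D / 2)).Nonempty := Set.nonempty_Icc.2 (by linarith)
    have hcc : ConvexOn ℝ Set.univ fun x : ℝ => x ^ 2 / (4 * D ^ 2) := by
      have := (Even.convexOn_pow (𝕜 := ℝ) even_two).smul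
        (show 0 ≤ (4 * D ^ 2)⁻¹ by positivity)
      simpa [div_eq_inv_mul] using this
    have hprod := ConvexTau.prod isCompact_Icc hne (convex_Icc _ _) (hμ 0)
      (isCompact_univ_pi fun _ => isCompact_Icc)
      (Set.univ_pi_nonempty_iff.2 fun _ => hne)
      (pi_compl_cube_eq_zero fun j : Fin N => hμ j.succ)
      (by fun_prop) hcc (by fun_prop) (convexTau_Icc hD (μ 0) (hμ 0))
      (ih (fun j => μ j.succ) fun j => hμ j.succ)
    have hmp : MeasurePreserving (Fin.consEquivL ℝ (fun _ : Fin (N + 1) => ℝ)).symm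
        (Measure.pi μ) ((μ 0).prod (Measure.pi fun j : Fin N => μ j.succ)) :=
      measurePreserving_piFinSuccAbove μ 0
    have := hprod.of_measurePreserving _ hmp
    convert this using 1
    · ext x
      change x ∈ Set.univ.pi _ ↔ x 0 ∈ Set.Icc _ _ ∧ (fun j : Fin N => x j.succ) ∈ Set.univ.pi _
      rw [Set.mem_univ_pi, Set.mem_univ_pi, Fin.forall_fin_succ]
    · ext x
      rw [Fin.sum_univ_succ, add_div]
      rfl

theorem continuous_of_sub_le_sqrt_sum {N : ℕ} {f : (Fin N → ℝ) → ℝ}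
    (hf : ∀ x y, f x - f y ≤ √(∑ i, (x i - y i) ^ 2)) : Continuous f := by
  refine continuous_iff_continuousAt.2 fun x => tendsto_iff_dist_tendsto_zero.2 ?_
  have hlim : Filter.Tendsto (fun y : Fin N → ℝ => √(∑ i, (y i - x i) ^ 2)) (nhds x) (nhds 0) := by
    have : Continuous fun y : Fin N → ℝ => √(∑ i, (y i - x i) ^ 2) := by fun_prop
    simpa using this.tendsto x
  refine squeeze_zero (fun _ => dist_nonneg) (fun y => ?_) hlim
  rw [Real.dist_eq, abs_sub_le_iff]
  refine ⟨hf y x, (hf x y).trans_eq ?_⟩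
  simp only [sub_sq_comm]

/-! ### Concentration of convex Lipschitz functions -/

section Concentration

variable {N : ℕ} {D : ℝ} {μ : Fin N → Measure ℝ} [∀ i, IsProbabilityMeasure (μ i)]

theorem integrable_pi_of_continuous (hμ : ∀ i, μ i (Set.Icc (-(D / 2)) (D / 2))ᶜ = 0)
    {f : (Fin N → ℝ) → ℝ} (hf : Continuous f) : Integrable f (Measure.pi μ) :=
  integrable_of_continuous_of_compl_null (isCompact_univ_pi fun _ => isCompact_Icc)
    (pi_compl_cube_eq_zero hμ) hf

theorem integral_exp_mul_le_of_convex_lipschitz (hD : 0 < D)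
    (hμ : ∀ i, μ i (Set.Icc (-(D / 2)) (D / 2))ᶜ = 0)
    {f : (Fin N → ℝ) → ℝ} (hfc : ConvexOn ℝ Set.univ f)
    (hf : ∀ x y, f x - f y ≤ √(∑ i, (x i - y i) ^ 2)) {t : ℝ} (ht : 0 ≤ t) :
    ∫ x, Real.exp (t * f x) ∂(Measure.pi μ)
      ≤ Real.exp (t ^ 2 * D ^ 2 + t * ∫ x, f x ∂(Measure.pi μ)) := by
  have hcont := continuous_of_sub_le_sqrt_sum hf
  have hi : ∀ g : (Fin N → ℝ) → ℝ, Continuous g → Integrable g (Measure.pi μ) := fun g hg =>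
    integrable_pi_of_continuous hμ hg
  set K : Set (Fin N → ℝ) := Set.univ.pi fun _ => Set.Icc (-(D / 2)) (D / 2)
  have hK : IsCompact K := isCompact_univ_pi fun _ => isCompact_Icc
  have hKne : K.Nonempty :=
    Set.univ_pi_nonempty_iff.2 fun _ => Set.nonempty_Icc.2 (by linarith)
  have htau := convexTau_pi hD N μ hμ (fun x => t * f x) (by fun_prop) (by
    simpa using hfc.smul ht)
  have hQ : ∀ x, t * f x - t ^ 2 * D ^ 2
      ≤ infConv K (fun x => (∑ i, x i ^ 2) / (4 * D ^ 2)) (fun x => t * f x) x := by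
    refine fun x => le_infConv hKne fun y _ => ?_
    have h₁ := mul_le_mul_of_nonneg_left (hf x y) ht
    have h₂ : √(∑ i, (x i - y i) ^ 2) ^ 2 = ∑ i, (x i - y i) ^ 2 :=
      Real.sq_sqrt (Finset.sum_nonneg fun _ _ => sq_nonneg _)
    simp only [Pi.sub_apply]
    rw [← h₂]
    set r := √(∑ i, (x i - y i) ^ 2)
    have h₃ : r ^ 2 / (4 * D ^ 2) = (r / (2 * D)) ^ 2 := by rw [div_pow]; ring
    have h₄ : t * r = 2 * (t * D) * (r / (2 * D)) := by field_simp
    rw [h₃]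
    -- AM-GM: `t * r ≤ t ^ 2 * D ^ 2 + r ^ 2 / (4 * D ^ 2)`.
    nlinarith [sq_nonneg (t * D - r / (2 * D))]
  have hJensen : Real.exp (-(t * ∫ x, f x ∂(Measure.pi μ)))
      ≤ ∫ x, Real.exp (-(t * f x)) ∂(Measure.pi μ) := by
    have := convexOn_exp.map_integral_le (μ := Measure.pi μ) (f := fun x => -(t * f x))
      Real.continuous_exp.continuousOn isClosed_univ (by simp) (hi _ (by fun_prop))
      (hi _ (by simp only [Function.comp_def]; fun_prop))
    rwa [integral_neg, integral_const_mul] at this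
  have hcQ : Continuous (infConv K (fun x => (∑ i, x i ^ 2) / (4 * D ^ 2)) fun x => t * f x) :=
    continuous_infConv hK (by fun_prop) (by fun_prop)
  have hmain : ∫ x, Real.exp (t * f x) ∂(Measure.pi μ) ≤ Real.exp (t ^ 2 * D ^ 2) *
      ∫ x, Real.exp (infConv K (fun x => (∑ i, x i ^ 2) / (4 * D ^ 2)) (fun x => t * f x) x)
        ∂(Measure.pi μ) := by
    rw [← integral_const_mul]
    refine integral_mono (hi _ (by fun_prop)) (hi _ (by fun_prop)) fun x => ?_
    rw [← Real.exp_add]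
    exact Real.exp_le_exp.2 (by linarith [hQ x])
  set I := ∫ x, Real.exp (infConv K (fun x => (∑ i, x i ^ 2) / (4 * D ^ 2))
    (fun x => t * f x) x) ∂(Measure.pi μ)
  have hI : 0 ≤ I := integral_nonneg fun _ => (Real.exp_pos _).le
  have hIle : I ≤ Real.exp (t * ∫ x, f x ∂(Measure.pi μ)) := by
    have := (mul_le_mul_of_nonneg_left hJensen hI).trans htau
    rw [Real.exp_neg] at this
    rwa [← div_eq_mul_inv, div_le_one (Real.exp_pos _)] at this
  calc _ ≤ Real.exp (t ^ 2 * D ^ 2) * I := hmain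
    _ ≤ Real.exp (t ^ 2 * D ^ 2) * Real.exp (t * ∫ x, f x ∂(Measure.pi μ)) := by gcongr
    _ = _ := (Real.exp_add _ _).symm

theorem measure_ge_le_of_convex_lipschitz (hD : 0 < D)
    (hμ : ∀ i, μ i (Set.Icc (-(D / 2)) (D / 2))ᶜ = 0)
    {f : (Fin N → ℝ) → ℝ} (hfc : ConvexOn ℝ Set.univ f)
    (hf : ∀ x y, f x - f y ≤ √(∑ i, (x i - y i) ^ 2)) {s : ℝ} (hs : 0 ≤ s) :
    (Measure.pi μ).real {x | (∫ y, f y ∂(Measure.pi μ)) + s ≤ f x}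
      ≤ Real.exp (-(s ^ 2 / (4 * D ^ 2))) := by
  have hcont := continuous_of_sub_le_sqrt_sum hf
  -- This parameter minimizes the Chernoff exponent `t ^ 2 * D ^ 2 - t * s`.
  have ht : 0 ≤ s / (2 * D ^ 2) := by positivity
  refine (ProbabilityTheory.measure_ge_le_exp_mul_mgf _ ht
    (integrable_pi_of_continuous hμ (by fun_prop))).trans ?_
  refine (mul_le_mul_of_nonneg_left
    (integral_exp_mul_le_of_convex_lipschitz hD hμ hfc hf ht) (Real.exp_pos _).le).trans_eq ?_
  rw [← Real.exp_add]
  congr 1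
  field_simp
  ring

end Concentration

/-! ### Application to the spectral norm -/

theorem Matrix.l2_opNorm_le_sqrt_sum_sq {m n : ℕ} (M : Matrix (Fin m) (Fin n) ℝ) :
    ‖M‖ ≤ √(∑ p : Fin m × Fin n, M p.1 p.2 ^ 2) := by
  rw [Matrix.l2_opNorm_def]
  refine ContinuousLinearMap.opNorm_le_bound _ (Real.sqrt_nonneg _) fun v => ?_
  change ‖Matrix.toEuclideanLin M v‖ ≤ _
  refine (sq_le_sq₀ (norm_nonneg _) (by positivity)).1 ?_
  rw [mul_pow, Real.sq_sqrt (Finset.sum_nonneg fun _ _ => sq_nonneg _),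
    EuclideanSpace.norm_sq_eq, EuclideanSpace.norm_sq_eq, Fintype.sum_prod_type, Finset.sum_mul]
  refine Finset.sum_le_sum fun i _ => ?_
  simp only [Real.norm_eq_abs, sq_abs]
  exact Finset.sum_mul_sq_le_sq_mul_sq Finset.univ (fun j => M i j) (fun j => v j)

theorem corollary7p3 {Ω : Type*} [MeasurableSpace Ω] (P : Measure Ω) [IsProbabilityMeasure P]
    (m n : ℕ) (A : Matrix (Fin m) (Fin n) ℝ) (X : Ω → Matrix (Fin m) (Fin n) ℝ) (D : ℝ)
    (hmeas : ∀ j k, Measurable (fun ω => X ω j k))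
    (hindep : iIndepFun (fun (p : Fin m × Fin n) (ω : Ω) => X ω p.1 p.2) P)
    (hmean : ∀ j k, ∫ ω, X ω j k ∂P = A j k)
    (hbound : ∀ j k, ∀ᵐ ω ∂P, |X ω j k| ≤ D / 2) :
    Integrable (fun ω => ‖A - X ω‖) P ∧
      ∀ δ : ℝ, 0 < δ →
        P.real {ω | (1 + δ) * (∫ ω', ‖A - X ω'‖ ∂P) < ‖A - X ω‖} ≤
          Real.exp (-(δ ^ 2 * (∫ ω', ‖A - X ω'‖ ∂P) ^ 2 / (4 * D ^ 2))) := by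
  set e : Fin m × Fin n ≃ Fin (m * n) := finProdFinEquiv with he
  set Y : Fin (m * n) → Ω → ℝ := fun i ω => X ω (e.symm i).1 (e.symm i).2 with hY
  set f : (Fin (m * n) → ℝ) → ℝ := fun x => ‖A - Matrix.of fun j k => x (e (j, k))‖ with hf_def
  have hYm : ∀ i, Measurable (Y i) := fun i => hmeas _ _
  have hYm' : Measurable fun ω i => Y i ω := measurable_pi_lambda _ hYm
  have hfY : ∀ ω, ‖A - X ω‖ = f fun i => Y i ω := by
    intro ω
    simp only [hf_def, hY, Equiv.symm_apply_apply]
    rfl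
  have hf : ∀ x y, f x - f y ≤ √(∑ i, (x i - y i) ^ 2) := by
    intro x y
    refine (norm_sub_norm_le _ _).trans ((Matrix.l2_opNorm_le_sqrt_sum_sq _).trans_eq ?_)
    rw [← e.sum_comp]
    congr 1
    refine Finset.sum_congr rfl fun p _ => ?_
    simp only [Matrix.sub_apply, Matrix.of_apply]
    ring
  have hfc : ConvexOn ℝ Set.univ f := by
    refine ⟨convex_univ, fun x _ y _ a b ha hb hab => ?_⟩
    have hsplit : (A - Matrix.of fun j k => (a • x + b • y) (e (j, k)))
        = a • (A - Matrix.of fun j k => x (e (j, k)))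
          + b • (A - Matrix.of fun j k => y (e (j, k))) := by
      ext j k
      simp only [Matrix.sub_apply, Matrix.add_apply, Matrix.smul_apply, Matrix.of_apply,
        Pi.add_apply, Pi.smul_apply, smul_eq_mul]
      linear_combination (-(A j k)) * hab
    simp only [hf_def]
    rw [hsplit]
    exact (convexOn_univ_norm (E := Matrix (Fin m) (Fin n) ℝ)).2 (Set.mem_univ _)
      (Set.mem_univ _) ha hb hab
  have hcont := continuous_of_sub_le_sqrt_sum hf
  have hpi : P.map (fun ω i => Y i ω) = Measure.pi fun i => P.map (Y i) :=
    (iIndepFun_iff_map_fun_eq_pi_map fun i => (hYm i).aemeasurable).1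
      (hindep.precomp e.symm.injective)
  have hprob : ∀ i, IsProbabilityMeasure (P.map (Y i)) := fun i =>
    Measure.isProbabilityMeasure_map (hYm i).aemeasurable
  have hμ : ∀ i, P.map (Y i) (Set.Icc (-(D / 2)) (D / 2))ᶜ = 0 := by
    intro i
    rw [Measure.map_apply (hYm i) measurableSet_Icc.compl]
    exact mem_ae_iff.1 ((hbound (e.symm i).1 (e.symm i).2).mono fun ω hω => abs_le.1 hω)
  have hmp : MeasurePreserving (fun ω i => Y i ω) P (Measure.pi fun i => P.map (Y i)) :=
    ⟨hYm', hpi⟩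
  simp only [hfY]
  refine ⟨hmp.integrable_comp_of_integrable (integrable_pi_of_continuous hμ hcont), fun δ hδ => ?_⟩
  have hE : ∫ ω, f (fun i => Y i ω) ∂P = ∫ x, f x ∂(Measure.pi fun i => P.map (Y i)) := by
    rw [← hpi, integral_map hYm'.aemeasurable hcont.aestronglyMeasurable]
  have hE0 : 0 ≤ ∫ ω, f (fun i => Y i ω) ∂P := integral_nonneg fun _ => norm_nonneg _
  rcases lt_or_ge 0 D with hD | hD
  · have key := measure_ge_le_of_convex_lipschitz hD hμ hfc hf (mul_nonneg hδ.le (hE ▸ hE0))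
    rw [← hE, mul_pow] at key
    refine le_trans ?_ key
    rw [measureReal_def, measureReal_def, ← hmp.measure_preimage
      (measurableSet_le measurable_const hcont.measurable).nullMeasurableSet]
    refine measureReal_mono fun ω hω => ?_
    simp only [Set.mem_ofPred_eq, Set.mem_preimage] at hω ⊢
    linarith
  -- For `D ≤ 0` the bound is 1: `D = 0` by division by zero, and `D < 0` because `hbound` then
  -- leaves no entries.
  · have htriv : (∫ ω, f (fun i => Y i ω) ∂P) ^ 2 / D ^ 2 = 0 := by
      rcases hD.eq_or_lt with rfl | hD
      · simp
      have hempty : IsEmpty (Fin (m * n)) := ⟨fun i => by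
        obtain ⟨ω, hω⟩ := (hbound (e.symm i).1 (e.symm i).2).exists
        linarith [abs_nonneg (X ω (e.symm i).1 (e.symm i).2)]⟩
      have hzero : ∀ x, f x = 0 := fun x =>
        le_antisymm ((Matrix.l2_opNorm_le_sqrt_sum_sq _).trans_eq (by
          rw [← e.symm.sum_comp]; simp)) (norm_nonneg _)
      simp [hzero]
    have : δ ^ 2 * (∫ ω, f (fun i => Y i ω) ∂P) ^ 2 / (4 * D ^ 2) = 0 := by
      rw [mul_div_mul_comm, htriv, mul_zero]
    rw [this, neg_zero, Real.exp_zero]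
    exact measureReal_le_one
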